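/- Let $\mathbb{H}=\{\operatorname{Im} z>0\}$ and let $\mathcal{P}$ be the set of Pick functions: holomorphic functions $\Phi$ on $\mathbb{C}\setminus\mathbb{R}$ with $\operatorname{Im}\Phi(z)/\operatorname{Im}z\ge 0$ for all $z\in\mathbb{C}\setminus\mathbb{R}$ and $\Phi(z)=\overline{\Phi(\bar z)}$ for $\operatorname{Im}z<0$. Let $\mathcal{P}_{\rm int}$ be the set of $f$ holomorphic on $\mathbb{C}\setminus\mathbb{R}$ with $f'\in\mathcal{P}$ and $f(-i)=\overline{f(i)}$. Let $\log\mathcal{P}=\{\log\Phi : \Phi\in\mathcal{P},\ \Phi\not\equiv 0\}$, where the logarithm is the principal one on $\mathbb{H}$ (with $\arg\Phi\in[0,\pi]$) and the function is extended to the lower half plane by $f(z)=\overline{f(\bar z)}$. Let $\Delta$ be the set of functions which on $\mathbb{H}$ have the form $$\beta+i\pi\theta_1(1-\theta)+\theta\log\frac{1}{a-z},\qquad \theta,\theta_1\in[0,1],\ a,\beta\in\mathbb{R}$$ (principal logarithm), extended to the lower half plane in the same way. Let $f\in\mathcal{P}_{\rm int}\cap\log\mathcal{P}$, and let $\nu$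 be a measure corresponding to $f$ in the representation $$f(z)=\beta+i\pi\nu(-\infty)+\int_{\mathbb{R}}\log\frac{\sqrt{1+t^2}}{t-z}\,d\nu(t),\qquad z\in\mathbb{H},$$ where $\beta\in\mathbb{R}$, the logarithm is principal, and $\nu$ is the Lebesgue–Stieltjes measure of a non-decreasing function on $\mathbb{R}$, also denoted by $\nu$, with values in $[0,1]$ and limit $\nu(-\infty)$ at $-\infty$. Put $J_\nu(\mathbb{R})=\sup_{x\in\mathbb{R}}\nu(\{x\})$ and $U(x,y)=\operatorname{Re}f(x+iy)$ for $y>0$, and let $U(x)$ be the finite non-tangential limit of $\operatorname{Re}f(z)$ as $z\in\mathbb{H}$ tends to $x\in\mathbb{R}$, at those $x$ where it exists. Then the support of $\nu$ has at least two points if and only if $f\in(\mathcal{P}_{\rm int}\cap\log\mathcal{P})\setminus\Delta$. In this case $J_\nu(\mathbb{R})<\nu(\mathbb{R})\le 1$, the limit $U(x)$ exists for almost every $x\in\mathbb{R}$, and (with $1/J_\nu(\mathbb{R})=+\infty$ if $J_\nu(\mathbb{R})=0$): (i) for all $0<y_1<y_2<+\infty$ and all real $p$ with $1/\nu(\mathbb{R})<p<1/J_\nu(\mathbb{R})$,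 $$\int_{\mathbb{R}}e^{p\,U(x,y_2)}\,dx<\int_{\mathbb{R}}e^{p\,U(x,y_1)}\,dx<\int_{\mathbb{R}}e^{p\,U(x)}\,dx<+\infty;$$ (ii) for all real $p>1/\nu(\mathbb{R})$ and all $y>0$, $$\int_{\mathbb{R}}\frac{e^{-p\,U(x,y)}}{1+x^2}\,dx=+\infty\qquad\text{and}\qquad\int_{\mathbb{R}}\frac{e^{-p\,U(x)}}{1+x^2}\,dx=+\infty,$$ that is, neither $e^{-p\,U(\cdot,y)}$ nor $e^{-p\,U}$ belongs to $L_1(\mathbb{R},dx/(1+x^2))$. -/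

import Mathlib

open MeasureTheory Filter Topology
open scoped ENNReal ComplexConjugate

noncomputable section

/-- The open set `ℂ \ ℝ`. -/
def offReal : Set ℂ := {z | z.im ≠ 0}

/-- Pick functions: holomorphic on `ℂ \ ℝ`, with `Im Φ(z) / Im z ≥ 0`, and symmetric under
reflection in the real axis. Only the values off the real line matter. -/
def Pick : Set (ℂ → ℂ) :=
  {Φ | DifferentiableOn ℂ Φ offReal ∧ (∀ z ∈ offReal, 0 ≤ (Φ z).im / z.im) ∧
    ∀ z : ℂ, z.im < 0 → Φ z = conj (Φ (conj z))}

/-- Primitives of Pick functions, normalized by `f(-i) = conj (f(i))`. -/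
def PrimPick : Set (ℂ → ℂ) :=
  {f | DifferentiableOn ℂ f offReal ∧ deriv f ∈ Pick ∧ f (-Complex.I) = conj (f Complex.I)}

/-- Logarithms of nonzero Pick functions: the principal logarithm on the upper half plane,
extended to the lower half plane by reflection. -/
def LogPick : Set (ℂ → ℂ) :=
  {f | ∃ Φ ∈ Pick, (∃ z ∈ offReal, Φ z ≠ 0) ∧ (∀ z : ℂ, 0 < z.im → f z = Complex.log (Φ z)) ∧
    ∀ z : ℂ, z.im < 0 → f z = conj (f (conj z))}

/-- The elementary functions `β + iπθ₁(1-θ) + θ log (1/(a-z))` on the upper half plane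
(principal logarithm), extended to the lower half plane by reflection. -/
def Elementary : Set (ℂ → ℂ) :=
  {f | (∃ θ ∈ Set.Icc (0 : ℝ) 1, ∃ θ₁ ∈ Set.Icc (0 : ℝ) 1, ∃ a β : ℝ, ∀ z : ℂ, 0 < z.im →
      f z = β + Complex.I * Real.pi * θ₁ * (1 - θ) + θ * Complex.log (1 / (a - z))) ∧
    ∀ z : ℂ, z.im < 0 → f z = conj (f (conj z))}

/-- `μ` is a measure corresponding to `f` in the canonical representation
`f(z) = β + iπν(-∞) + ∫ log (√(1+t²)/(t-z)) dν(t)` on the upper half plane: `μ` is the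
Lebesgue-Stieltjes measure of a non-decreasing function `ν` on the line with `0 ≤ ν ≤ 1`,
and `c` is the limit `ν(-∞)`. -/
def IsReprMeasure (f : ℂ → ℂ) (μ : Measure ℝ) : Prop :=
  ∃ (ν : ℝ → ℝ) (hν : Monotone ν) (c β : ℝ), (∀ x, 0 ≤ ν x ∧ ν x ≤ 1) ∧
    Tendsto ν atBot (𝓝 c) ∧ μ = hν.stieltjesFunction.measure ∧
    ∀ z : ℂ, 0 < z.im → f z = β + Complex.I * Real.pi * c +
      ∫ t : ℝ, Complex.log (((Real.sqrt (1 + t ^ 2) : ℝ) : ℂ) / (t - z)) ∂μ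

/-- The largest point mass of `μ` on `A`. -/
def maxAtom (μ : Measure ℝ) (A : Set ℝ) : ℝ≥0∞ := ⨆ x ∈ A, μ {x}

/-- `U(x,y) = Re f(x+iy)`. -/
def reU (f : ℂ → ℂ) (x y : ℝ) : ℝ := (f (x + y * Complex.I)).re

/-- `Re f(z)` tends to the finite number `u` as `z` in the upper half plane tends to `x`
non-tangentially, that is, within every cone `|Re z - x| ≤ κ Im z`. -/
def HasNontangentialReLimit (f : ℂ → ℂ) (x u : ℝ) : Prop :=
  ∀ κ : ℝ, 0 < κ → Tendsto (fun z : ℂ => (f z).re)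
    (𝓝[{z : ℂ | 0 < z.im ∧ |z.re - x| ≤ κ * z.im}] (x : ℂ)) (𝓝 u)

open Classical in
/-- The boundary value `U(x)`: the non-tangential limit of `Re f` at `x`, and `0` at those `x`
where there is no finite limit. -/
def bdryU (f : ℂ → ℂ) (x : ℝ) : ℝ :=
  if h : ∃ u, HasNontangentialReLimit f x u then h.choose else 0

end

/-! On the upper half plane `Re f` is a constant plus the logarithmic potential `V` of `μ`, so only
`V` and the total mass `m = μ(ℝ)` matter in (i) and (ii).

Finiteness of `∫ e^{pV}`: Jensen bounds `e^{pV(x)}` by an average of the kernel's `pm`-th powers,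
which are locally integrable when `pm < 1`. Near a point whose atom is below `1/p`, a small ball has
mass below `1/p`; what lies outside contributes a bounded factor. Near infinity most of the mass
sits in a bounded set and gives decay close to `|x|^(-pm)`, integrable since `pm > 1`, while the
remaining mass costs a small power. A finite cover joins the two estimates.

Strict monotonicity in the height, down to height `0`, is pointwise: `|t - (x + iy)|` increases with
`y`. Divergence in (ii) follows from AM-GM: `e^{pV} + e^{-pV}/(1+x²)` dominates `1/(2x)`, and
`e^{pV}` is integrable near infinity.

For the support, the boundary values of `Im f` increase exactly where `μ` has mass; for an
elementary function they can increase only at `a`. -/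

noncomputable section

/-! ### The logarithmic kernel -/

/-- The real part of the kernel `log (√(1+t²)/(t-z))`. -/
def logKernel (z : ℂ) (t : ℝ) : ℝ := Real.log (Real.sqrt (1 + t ^ 2) / ‖(t : ℂ) - z‖)

/-- The logarithmic potential of a measure on the line, with the kernel `logKernel`. -/
def logPotential (μ : Measure ℝ) (z : ℂ) : ℝ := ∫ t, logKernel z t ∂μ

theorem measurable_logKernel_uncurry : Measurable (Function.uncurry logKernel) := by
  unfold logKernel Function.uncurry
  fun_prop

theorem measurable_logKernel (z : ℂ) : Measurable (logKernel z) :=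
  measurable_logKernel_uncurry.comp measurable_prodMk_left

theorem measurable_logKernel_real : Measurable fun q : ℝ × ℝ => logKernel q.1 q.2 := by
  unfold logKernel
  fun_prop

theorem sqrt_one_add_sq_pos (t : ℝ) : 0 < Real.sqrt (1 + t ^ 2) :=
  Real.sqrt_pos.2 (by positivity)

theorem sqrt_one_add_sq_le (t : ℝ) : Real.sqrt (1 + t ^ 2) ≤ 1 + |t| := by
  rw [Real.sqrt_le_left (by positivity)]
  nlinarith [sq_abs t, abs_nonneg t]

theorem one_le_sqrt_one_add_sq (t : ℝ) : 1 ≤ Real.sqrt (1 + t ^ 2) :=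
  Real.one_le_sqrt.2 (by nlinarith [sq_nonneg t])

theorem abs_le_sqrt_one_add_sq (t : ℝ) : |t| ≤ Real.sqrt (1 + t ^ 2) :=
  Real.abs_le_sqrt (by linarith)

theorem norm_sub_le_sqrt_mul (z : ℂ) (t : ℝ) :
    ‖(t : ℂ) - z‖ ≤ Real.sqrt (1 + t ^ 2) * (1 + ‖z‖) := by
  have h1 := norm_sub_le (t : ℂ) z
  rw [Complex.norm_real, Real.norm_eq_abs] at h1
  nlinarith [one_le_sqrt_one_add_sq t, abs_le_sqrt_one_add_sq t, norm_nonneg z]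

theorem neg_log_le_logKernel (z : ℂ) (t : ℝ) : -Real.log (1 + ‖z‖) ≤ logKernel z t := by
  unfold logKernel
  rcases (norm_nonneg ((t : ℂ) - z)).eq_or_lt with h | h
  -- At `z = t` the kernel is `0`, by the conventions for division by zero and `Real.log 0`.
  · rw [← h]
    simpa using Real.log_nonneg (by linarith [norm_nonneg z])
  · rw [← Real.log_inv]
    refine Real.log_le_log (by positivity) ?_
    rw [le_div_iff₀ h, inv_mul_le_iff₀ (by positivity), mul_comm]
    exact norm_sub_le_sqrt_mul z t

theorem sqrt_one_add_sq_le_add (z : ℂ) (t : ℝ) :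
    Real.sqrt (1 + t ^ 2) ≤ (1 + ‖z‖) + ‖(t : ℂ) - z‖ := by
  have h1 := norm_add_le ((t : ℂ) - z) z
  rw [sub_add_cancel, Complex.norm_real, Real.norm_eq_abs] at h1
  linarith [sqrt_one_add_sq_le t]

/-- The numerator exceeds `‖t - z‖` by at most `1 + ‖z‖`, so away from the singularity the kernel is
bounded uniformly in `t`, even as `t → ±∞`. -/
theorem logKernel_le_of_le_norm {z : ℂ} {t δ : ℝ} (hδ : 0 < δ) (h : δ ≤ ‖(t : ℂ) - z‖) :
    logKernel z t ≤ Real.log (1 + (1 + ‖z‖) / δ) := by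
  unfold logKernel
  have h0 : 0 < ‖(t : ℂ) - z‖ := hδ.trans_le h
  refine Real.log_le_log (div_pos (sqrt_one_add_sq_pos t) h0) ?_
  calc Real.sqrt (1 + t ^ 2) / ‖(t : ℂ) - z‖
      ≤ ((1 + ‖z‖) + ‖(t : ℂ) - z‖) / ‖(t : ℂ) - z‖ := by
        gcongr; exact sqrt_one_add_sq_le_add z t
    _ = 1 + (1 + ‖z‖) / ‖(t : ℂ) - z‖ := by field_simp; ring
    _ ≤ _ := by gcongr

theorem im_le_norm_ofReal_sub (z : ℂ) (t : ℝ) : z.im ≤ ‖(t : ℂ) - z‖ := by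
  have := Complex.abs_im_le_norm ((t : ℂ) - z)
  simp only [Complex.sub_im, Complex.ofReal_im, zero_sub, abs_neg] at this
  exact (le_abs_self _).trans this

theorem abs_logKernel_le {z : ℂ} (hz : 0 < z.im) (t : ℝ) :
    |logKernel z t| ≤ Real.log (1 + ‖z‖) + Real.log (1 + (1 + ‖z‖) / z.im) := by
  have h1 := neg_log_le_logKernel z t
  have h2 := logKernel_le_of_le_norm hz (im_le_norm_ofReal_sub z t)
  have h3 : 0 ≤ Real.log (1 + ‖z‖) := Real.log_nonneg (by linarith [norm_nonneg z])
  have h4 : 0 ≤ Real.log (1 + (1 + ‖z‖) / z.im) :=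
    Real.log_nonneg (le_add_of_nonneg_right (by positivity))
  rw [abs_le]
  constructor <;> linarith

theorem integrable_logKernel {z : ℂ} (hz : 0 < z.im) (μ : Measure ℝ) [IsFiniteMeasure μ] :
    Integrable (logKernel z) μ :=
  Integrable.of_bound (measurable_logKernel z).aestronglyMeasurable _
    (ae_of_all _ fun t => (Real.norm_eq_abs _).trans_le (abs_logKernel_le hz t))

/-! ### Uniform integrability of powers of the kernel -/

/-- The singular part of `|s|^(-q)`, cut off at `|s| = 1`. -/
def cutPow (q s : ℝ) : ℝ := (Set.Icc (-1) 1).indicator (fun s => |s| ^ (-q)) s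

theorem cutPow_nonneg (q s : ℝ) : 0 ≤ cutPow q s :=
  Set.indicator_nonneg (fun _ _ => by positivity) s

theorem integrable_cutPow {q : ℝ} (hq : q < 1) : Integrable (cutPow q) := by
  unfold cutPow
  rw [integrable_indicator_iff measurableSet_Icc]
  have h0 : IntegrableOn (fun s : ℝ => |s| ^ (-q)) (Set.Ioc 0 1) := by
    have := (intervalIntegral.intervalIntegrable_rpow' (a := 0) (b := 1) (r := -q)
      (by linarith)).1
    refine this.congr_fun (fun s hs => ?_) measurableSet_Ioc
    simp only [abs_of_pos hs.1]
  have h1 : IntegrableOn (fun s : ℝ => |s| ^ (-q)) (Set.Icc 0 1) :=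
    (integrableOn_Icc_iff_integrableOn_Ioc).2 h0
  have h2 : IntegrableOn (fun s : ℝ => |s| ^ (-q)) (Set.Icc (-1) 0) := by
    simpa using h1.comp_neg
  have h3 := h2.union h1
  rwa [Set.Icc_union_Icc_eq_Icc (by norm_num) (by norm_num)] at h3

theorem rpow_neg_le_one_add_cutPow {q : ℝ} (hq : 0 ≤ q) (s : ℝ) :
    |s| ^ (-q) ≤ 1 + cutPow q s := by
  by_cases h : s ∈ Set.Icc (-1 : ℝ) 1
  · rw [cutPow, Set.indicator_of_mem h]; linarith
  · have h1 : 1 ≤ |s| := by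
      by_contra! h2
      exact h ⟨(abs_lt.1 h2).1.le, (abs_lt.1 h2).2.le⟩
    have := Real.rpow_le_one_of_one_le_of_nonpos h1 (neg_nonpos.2 hq)
    linarith [cutPow_nonneg q s]

/-- Separates growth in `x` from the singularity at `t`; `q ≤ 1` makes `r ↦ r ^ q` subadditive. -/
theorem exp_mul_logKernel_le {q : ℝ} (hq : 0 ≤ q) (hq1 : q ≤ 1) (x t : ℝ) :
    Real.exp (q * logKernel x t) ≤ (1 + |x|) ^ q * (2 + cutPow q (x - t)) := by
  have hx : (1 : ℝ) ≤ (1 + |x|) ^ q := Real.one_le_rpow (by linarith [abs_nonneg x]) hq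
  have hc := cutPow_nonneg q (x - t)
  rcases eq_or_ne t x with rfl | hne
  · have : logKernel t t = 0 := by simp [logKernel]
    rw [this, mul_zero, Real.exp_zero]
    nlinarith
  · have hn : ‖(t : ℂ) - x‖ = |x - t| := by
      rw [← Complex.ofReal_sub, Complex.norm_real, Real.norm_eq_abs, abs_sub_comm]
    have hpos : 0 < |x - t| := abs_pos.2 (sub_ne_zero.2 hne.symm)
    have h1 := logKernel_le_of_le_norm (z := x) (t := t) hpos hn.ge
    rw [Complex.norm_real, Real.norm_eq_abs] at h1
    calc Real.exp (q * logKernel x t)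
        ≤ Real.exp (q * Real.log (1 + (1 + |x|) / |x - t|)) := by gcongr
      _ = (1 + (1 + |x|) / |x - t|) ^ q := by
          rw [Real.rpow_def_of_pos (by positivity), mul_comm]
      _ ≤ 1 ^ q + ((1 + |x|) / |x - t|) ^ q :=
          Real.rpow_add_le_add_rpow zero_le_one (by positivity) hq hq1
      _ = 1 + (1 + |x|) ^ q * |x - t| ^ (-q) := by
          rw [Real.one_rpow, Real.div_rpow (by positivity) (by positivity),
            Real.rpow_neg (by positivity), div_eq_mul_inv]
      _ ≤ (1 + |x|) ^ q + (1 + |x|) ^ q * (1 + cutPow q (x - t)) := by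
          gcongr
          exact rpow_neg_le_one_add_cutPow hq _
      _ = _ := by ring

/-- The bound is uniform in `t` because the singular part is a translate of one integrable function.
The weight absorbs `(1 + |x|) ^ q` and leaves an integrable power, as `s - q > 1`. -/
theorem exists_lintegral_exp_mul_logKernel_le {q s : ℝ} (hq : 0 ≤ q) (hq1 : q < 1)
    (hs : 1 + q < s) : ∃ C : ℝ≥0∞, C < ⊤ ∧ ∀ t : ℝ,
      ∫⁻ x : ℝ, ENNReal.ofReal ((1 + |x|) ^ (-s) * Real.exp (q * logKernel x t)) ≤ C := by
  have hint : Integrable (fun x : ℝ => (1 + |x|) ^ (-(s - q))) := by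
    have := integrable_one_add_norm (E := ℝ) (μ := volume) (r := s - q)
      (by simp; linarith)
    simpa only [Real.norm_eq_abs] using this
  refine ⟨2 * (∫⁻ x : ℝ, ENNReal.ofReal ((1 + |x|) ^ (-(s - q)))) +
    ∫⁻ x : ℝ, ENNReal.ofReal (cutPow q x), ?_, fun t => ?_⟩
  · exact ENNReal.add_lt_top.2 ⟨ENNReal.mul_lt_top (by simp) hint.lintegral_lt_top,
      (integrable_cutPow hq1).lintegral_lt_top⟩
  · rw [← lintegral_sub_right_eq_self (fun x => ENNReal.ofReal (cutPow q x)) t,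
      ← lintegral_const_mul' _ _ (by simp), ← lintegral_add_left (by fun_prop)]
    refine lintegral_mono fun x => ?_
    have hb : (0 : ℝ) < 1 + |x| := by positivity
    have hc := cutPow_nonneg q (x - t)
    have e : (1 + |x|) ^ (-(s - q)) = (1 + |x|) ^ (-s) * (1 + |x|) ^ q := by
      rw [← Real.rpow_add hb]; congr 1; ring
    have hle1 : (1 + |x|) ^ (-(s - q)) ≤ 1 :=
      Real.rpow_le_one_of_one_le_of_nonpos (by linarith [abs_nonneg x]) (by linarith)
    have : (2 : ℝ≥0∞) = ENNReal.ofReal 2 := by simp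
    rw [this, ← ENNReal.ofReal_mul (by norm_num), ← ENNReal.ofReal_add (by positivity) hc]
    refine ENNReal.ofReal_le_ofReal ?_
    calc (1 + |x|) ^ (-s) * Real.exp (q * logKernel x t)
        ≤ (1 + |x|) ^ (-s) * ((1 + |x|) ^ q * (2 + cutPow q (x - t))) := by
          gcongr; exact exp_mul_logKernel_le hq hq1.le x t
      _ = (1 + |x|) ^ (-(s - q)) * (2 + cutPow q (x - t)) := by rw [e]; ring
      _ ≤ _ := by nlinarith

/-! ### Exponential integrability of the potential -/

/-- Jensen's inequality for the exponential, in a form that needs no integrability. -/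
theorem exp_mul_integral_le {α : Type*} [MeasurableSpace α] (μ : Measure α) [IsFiniteMeasure μ]
    (g : α → ℝ) (hg : Measurable g) (p : ℝ) :
    ENNReal.ofReal (Real.exp (p * ∫ t, g t ∂μ)) ≤
      1 + (μ Set.univ)⁻¹ * ∫⁻ t, ENNReal.ofReal (Real.exp (p * μ.real Set.univ * g t)) ∂μ := by
  rcases eq_or_ne μ 0 with rfl | h0
  · simp
  by_cases hi : Integrable g μ
  swap
  -- The Bochner integral is `0` by default here, and the summand `1` absorbs `exp 0`.
  · rw [integral_undef hi]; simp
  have : NeZero μ := ⟨h0⟩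
  have hm : μ Set.univ ≠ 0 := by simpa using h0
  have hmr : μ.real Set.univ ≠ 0 := by simp [measureReal_eq_zero_iff, h0]
  refine le_add_left ?_
  set G : α → ℝ := fun t => p * μ.real Set.univ * g t with hG
  have hGi : Integrable G μ := hi.const_mul _
  have hGm : Measurable G := hg.const_mul _
  by_cases he : Integrable (Real.exp ∘ G) μ
  · have hJ := convexOn_exp.map_average_le Real.continuous_exp.continuousOn isClosed_univ
      (by simp) hGi he
    have e1 : ⨍ t, G t ∂μ = p * ∫ t, g t ∂μ := by
      rw [average_eq, hG, integral_const_mul, smul_eq_mul]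
      field_simp
    rw [e1] at hJ
    have e2 : ∫⁻ t, ENNReal.ofReal (Real.exp (G t)) ∂μ
        = ENNReal.ofReal (∫ t, Real.exp (G t) ∂μ) :=
      (ofReal_integral_eq_lintegral_ofReal he (ae_of_all _ fun t => (Real.exp_pos _).le)).symm
    rw [e2]
    refine (ENNReal.ofReal_le_ofReal hJ).trans_eq ?_
    rw [average_eq, smul_eq_mul, ENNReal.ofReal_mul (by positivity),
      ENNReal.ofReal_inv_of_pos (by positivity), ofReal_measureReal]
  · have : ∫⁻ t, ENNReal.ofReal (Real.exp (G t)) ∂μ = ⊤ := by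
      by_contra hne
      refine he ⟨(Real.measurable_exp.comp hGm).aestronglyMeasurable, ?_⟩
      change HasFiniteIntegral (fun t => Real.exp (G t)) μ
      rw [hasFiniteIntegral_iff_ofReal (ae_of_all _ fun t => (Real.exp_pos _).le)]
      exact lt_top_iff_ne_top.2 hne
    rw [this, ENNReal.mul_top (ENNReal.inv_ne_zero.2 (measure_ne_top _ _))]
    exact le_top

/-- Jensen replaces `p` by `q = p * μ.real univ` inside the `μ`-integral; Tonelli and the bound
uniform in `t` finish. -/
theorem lintegral_weight_mul_exp_logPotential_lt_top (μ : Measure ℝ) [IsFiniteMeasure μ]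
    {p s : ℝ} (hp : 0 ≤ p) (hq : p * μ.real Set.univ < 1) (hs : 1 + p * μ.real Set.univ < s) :
    ∫⁻ x : ℝ, ENNReal.ofReal ((1 + |x|) ^ (-s) * Real.exp (p * logPotential μ x)) < ⊤ := by
  have hq0 : 0 ≤ p * μ.real Set.univ := by positivity
  obtain ⟨C, hC, hle⟩ := exists_lintegral_exp_mul_logKernel_le hq0 hq hs
  have hint : Integrable (fun x : ℝ => (1 + |x|) ^ (-s)) := by
    have := integrable_one_add_norm (E := ℝ) (μ := volume) (r := s) (by simp; linarith)
    simpa only [Real.norm_eq_abs] using this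
  set w : ℝ → ℝ≥0∞ := fun x => ENNReal.ofReal ((1 + |x|) ^ (-s)) with hw
  set k : ℝ → ℝ → ℝ≥0∞ := fun x t =>
    ENNReal.ofReal ((1 + |x|) ^ (-s) * Real.exp (p * μ.real Set.univ * logKernel x t)) with hk
  have hkm : Measurable (Function.uncurry k) := by
    have := measurable_logKernel_real
    simp only [hk]
    fun_prop
  have hwm : Measurable w := by fun_prop
  have hpt : ∀ x : ℝ, ENNReal.ofReal ((1 + |x|) ^ (-s) * Real.exp (p * logPotential μ x)) ≤
      w x + (μ Set.univ)⁻¹ * ∫⁻ t, k x t ∂μ := by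
    intro x
    have hJ := exp_mul_integral_le μ (logKernel x) (measurable_logKernel x) p
    rw [ENNReal.ofReal_mul (by positivity)]
    refine (mul_le_mul_right hJ (w x)).trans_eq ?_
    have : ∫⁻ t, k x t ∂μ = w x * ∫⁻ t, ENNReal.ofReal
        (Real.exp (p * μ.real Set.univ * logKernel x t)) ∂μ := by
      rw [← lintegral_const_mul' _ _ (by simp [hw])]
      refine lintegral_congr fun t => ?_
      simp only [hk, hw]
      rw [ENNReal.ofReal_mul (by positivity)]
    rw [this]
    ring
  refine (lintegral_mono hpt).trans_lt ?_
  rw [lintegral_add_left hwm]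
  refine ENNReal.add_lt_top.2 ⟨hint.lintegral_lt_top, ?_⟩
  rcases eq_or_ne μ 0 with rfl | h0
  · simp
  have hm : μ Set.univ ≠ 0 := by simpa using h0
  rw [lintegral_const_mul' _ _ (ENNReal.inv_ne_top.2 hm)]
  refine ENNReal.mul_lt_top (ENNReal.inv_lt_top.2 hm.bot_lt) ?_
  rw [lintegral_lintegral_swap hkm.aemeasurable]
  refine (lintegral_mono hle).trans_lt ?_
  rw [lintegral_const]
  exact ENNReal.mul_lt_top hC (measure_lt_top _ _)

/-- By Tonelli `exp (logKernel x t / 2)` is `μ`-integrable in `t` for a.e. `x`. It controls the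
kernel from above through `u + 1 ≤ exp u`; from below the kernel is bounded. -/
theorem ae_integrable_logKernel (μ : Measure ℝ) [IsFiniteMeasure μ] :
    ∀ᵐ x : ℝ, Integrable (logKernel x) μ := by
  obtain ⟨C, hC, hle⟩ := exists_lintegral_exp_mul_logKernel_le (q := 1 / 2) (s := 2)
    (by norm_num) (by norm_num) (by norm_num)
  set k : ℝ → ℝ → ℝ≥0∞ := fun x t =>
    ENNReal.ofReal ((1 + |x|) ^ (-2 : ℝ) * Real.exp (1 / 2 * logKernel x t)) with hk
  have hkm : Measurable (Function.uncurry k) := by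
    have := measurable_logKernel_real
    simp only [hk]
    fun_prop
  have hfin : ∫⁻ x, ∫⁻ t, k x t ∂μ ≠ ⊤ := by
    rw [lintegral_lintegral_swap hkm.aemeasurable]
    refine ((lintegral_mono hle).trans_lt ?_).ne
    rw [lintegral_const]
    exact ENNReal.mul_lt_top hC (measure_lt_top _ _)
  filter_upwards [ae_lt_top hkm.lintegral_prod_right' hfin] with x hx
  have hb : (0 : ℝ) < (1 + |x|) ^ (-2 : ℝ) := by positivity
  have hei : Integrable (fun t => (1 + |x|) ^ (-2 : ℝ) * Real.exp (1 / 2 * logKernel x t)) μ := by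
    refine ⟨(((measurable_logKernel x).const_mul _).exp.const_mul _).aestronglyMeasurable, ?_⟩
    rw [hasFiniteIntegral_iff_ofReal (ae_of_all _ fun t => by positivity)]
    exact hx
  have hei' : Integrable (fun t => Real.exp (1 / 2 * logKernel x t)) μ :=
    (integrable_const_mul_iff (isUnit_iff_ne_zero.2 hb.ne') _).1 hei
  refine ((hei'.const_mul 2).add (integrable_const (Real.log (1 + ‖(x : ℂ)‖)))).mono'
    (measurable_logKernel x).aestronglyMeasurable (ae_of_all _ fun t => ?_)
  have h1 := neg_log_le_logKernel x t
  have h2 := Real.add_one_le_exp (1 / 2 * logKernel x t)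
  have h3 : 0 ≤ Real.log (1 + ‖(x : ℂ)‖) :=
    Real.log_nonneg (by linarith [norm_nonneg (x : ℂ)])
  have h4 := Real.exp_pos (1 / 2 * logKernel x t)
  simp only [Pi.add_apply]
  rw [Real.norm_eq_abs, abs_le]
  constructor <;> linarith

theorem ae_measure_singleton_eq_zero (μ : Measure ℝ) [IsFiniteMeasure μ] :
    ∀ᵐ x : ℝ, μ {x} = 0 := by
  have h := Measure.countable_meas_pos_of_disjoint_iUnion (μ := μ) (As := fun x : ℝ => {x})
    (fun x => measurableSet_singleton x) (fun x y hxy => by simpa using hxy)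
  have h0 := h.measure_zero volume
  rw [ae_iff]
  simpa [pos_iff_ne_zero] using h0

theorem measurable_logPotential (μ : Measure ℝ) [IsFiniteMeasure μ] :
    Measurable (logPotential μ) :=
  (measurable_logKernel_uncurry.stronglyMeasurable.integral_prod_right' (ν := μ)).measurable

theorem logPotential_restrict_add_compl {μ : Measure ℝ} {S : Set ℝ} (hS : MeasurableSet S)
    {z : ℂ} (hz : Integrable (logKernel z) μ) :
    logPotential (μ.restrict S) z + logPotential (μ.restrict Sᶜ) z = logPotential μ z :=
  integral_add_compl hS hz

theorem logPotential_restrict_le {μ : Measure ℝ} [IsFiniteMeasure μ] {S : Set ℝ}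
    (hS : MeasurableSet S) {z : ℂ} (hz : Integrable (logKernel z) μ) {M : ℝ}
    (hM : ∀ t ∈ S, logKernel z t ≤ M) :
    logPotential (μ.restrict S) z ≤ μ.real S * M := by
  have := setIntegral_mono_on hz.integrableOn (integrableOn_const (measure_ne_top μ S)) hS hM
  simpa [logPotential] using this

theorem exists_lintegral_ball_exp_logPotential_lt_top (μ : Measure ℝ) [IsFiniteMeasure μ]
    {p : ℝ} (hp : 0 < p) {x₀ : ℝ} (h : μ {x₀} < ENNReal.ofReal (1 / p)) :
    ∃ δ > 0, ∫⁻ x in Metric.ball x₀ δ, ENNReal.ofReal (Real.exp (p * logPotential μ x)) < ⊤ := by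
  obtain ⟨U, hxU, hUo, hU⟩ := Set.exists_isOpen_lt_of_lt {x₀} _ h
  obtain ⟨δ, hδ, hball⟩ := Metric.isOpen_iff.1 hUo x₀ (hxU rfl)
  set S := Metric.ball x₀ δ with hSdef
  have hS : MeasurableSet S := measurableSet_ball
  have hμS : p * (μ.restrict S).real Set.univ < 1 := by
    have h1 : μ S < ENNReal.ofReal (1 / p) := (measure_mono hball).trans_lt hU
    rw [measureReal_restrict_apply_univ]
    have h2 : μ.real S < 1 / p := (ENNReal.lt_ofReal_iff_toReal_lt (measure_ne_top _ _)).1 h1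
    rwa [lt_div_iff₀ hp, mul_comm] at h2
  have hfin := lintegral_weight_mul_exp_logPotential_lt_top (μ.restrict S) (s := 2) hp.le hμS
    (by linarith)
  set M := Real.log (1 + (1 + (|x₀| + δ)) / (δ / 2)) with hM
  -- The first factor bounds the contribution of `Sᶜ`, at distance at least `δ / 2` from the
  -- half-radius ball; the second cancels the weight `(1 + |x|) ^ (-2)`.
  set C : ℝ := Real.exp (p * (μ.real Sᶜ * M)) * (1 + (|x₀| + δ)) ^ (2 : ℝ) with hC
  refine ⟨δ / 2, by positivity, ?_⟩
  have hae : ∀ᵐ x : ℝ, x ∈ Metric.ball x₀ (δ / 2) →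
      ENNReal.ofReal (Real.exp (p * logPotential μ x)) ≤ ENNReal.ofReal C *
      ENNReal.ofReal ((1 + |x|) ^ (-2 : ℝ) * Real.exp (p * logPotential (μ.restrict S) x)) := by
    filter_upwards [ae_integrable_logKernel μ] with x hx hxb
    rw [Metric.mem_ball, Real.dist_eq] at hxb
    have hxabs : |x| ≤ |x₀| + δ := by
      have := abs_sub_abs_le_abs_sub x x₀
      linarith
    have hle : logPotential (μ.restrict Sᶜ) x ≤ μ.real Sᶜ * M := by
      refine logPotential_restrict_le hS.compl hx fun t ht => ?_
      have ht' : δ ≤ |t - x₀| := by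
        simpa [hSdef, Real.dist_eq] using ht
      have h1 : δ / 2 ≤ ‖(t : ℂ) - (x : ℂ)‖ := by
        rw [← Complex.ofReal_sub, Complex.norm_real, Real.norm_eq_abs]
        have := abs_sub_le t x x₀
        linarith
      refine (logKernel_le_of_le_norm (by positivity) h1).trans ?_
      rw [Complex.norm_real, Real.norm_eq_abs]
      exact Real.log_le_log (by positivity) (by gcongr)
    rw [← ENNReal.ofReal_mul (by positivity)]
    refine ENNReal.ofReal_le_ofReal ?_
    rw [← logPotential_restrict_add_compl hS hx, mul_add, Real.exp_add]
    have hone : 1 ≤ (1 + (|x₀| + δ)) ^ (2 : ℝ) * (1 + |x|) ^ (-2 : ℝ) := by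
      rw [Real.rpow_neg (by positivity), ← div_eq_mul_inv, one_le_div (by positivity)]
      gcongr
    calc Real.exp (p * logPotential (μ.restrict S) x) *
          Real.exp (p * logPotential (μ.restrict Sᶜ) x)
        ≤ Real.exp (p * logPotential (μ.restrict S) x) * Real.exp (p * (μ.real Sᶜ * M)) := by
          gcongr
      _ ≤ (Real.exp (p * logPotential (μ.restrict S) x) * Real.exp (p * (μ.real Sᶜ * M))) *
          ((1 + (|x₀| + δ)) ^ (2 : ℝ) * (1 + |x|) ^ (-2 : ℝ)) :=
          le_mul_of_one_le_right (by positivity) hone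
      _ = _ := by rw [hC]; ring
  refine (setLIntegral_mono_ae' measurableSet_ball hae).trans_lt ?_
  rw [lintegral_const_mul' _ _ (by simp)]
  exact ENNReal.mul_lt_top (by simp) ((setLIntegral_le_lintegral _ _).trans_lt hfin)

theorem exists_lintegral_tail_exp_logPotential_lt_top (μ : Measure ℝ) [IsFiniteMeasure μ]
    {p : ℝ} (hp : 0 < p) (h : 1 < p * μ.real Set.univ) :
    ∃ R, ∫⁻ x in {x : ℝ | R < |x|}, ENNReal.ofReal (Real.exp (p * logPotential μ x)) < ⊤ := by
  have htend : Tendsto (fun n : ℕ => μ.real (Metric.closedBall (0 : ℝ) n)) atTop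
      (𝓝 (μ.real Set.univ)) := by
    have h1 := tendsto_measure_iUnion_atTop (μ := μ)
      (s := fun n : ℕ => Metric.closedBall (0 : ℝ) n)
      (fun a b hab => Metric.closedBall_subset_closedBall (by exact_mod_cast hab))
    rw [Metric.iUnion_closedBall_nat] at h1
    exact (ENNReal.tendsto_toReal (measure_ne_top _ _)).comp h1
  have ht1 : Tendsto (fun n : ℕ => p * (μ.real Set.univ - μ.real (Metric.closedBall (0 : ℝ) n)))
      atTop (𝓝 0) := by
    simpa using (htend.const_sub (μ.real Set.univ)).const_mul p
  have ht2 : Tendsto (fun n : ℕ => p * μ.real (Metric.closedBall (0 : ℝ) n) -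
      p * (μ.real Set.univ - μ.real (Metric.closedBall (0 : ℝ) n)))
      atTop (𝓝 (p * μ.real Set.univ)) := by
    simpa using (htend.const_mul p).sub ht1
  -- With `q` equal to `p` times the mass outside the ball and `s` equal to `p` times the mass
  -- inside, these say `q < 1` and `1 + q < s`, as the weighted estimate requires. The radius is at
  -- least `1` so that `|x| > 2A` and `|t| ≤ A` give `|x - t| ≥ (1 + |x|) / 4`.
  obtain ⟨n, hn1, hn2, hn3⟩ := ((ht1.eventually_lt_const one_pos).and
    ((ht2.eventually_const_lt h).and (eventually_ge_atTop 1))).exists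
  have hA : (1 : ℝ) ≤ n := by exact_mod_cast hn3
  set A : ℝ := (n : ℝ)
  set S := Metric.closedBall (0 : ℝ) A with hSdef
  have hS : MeasurableSet S := measurableSet_closedBall
  have hcompl : (μ.restrict Sᶜ).real Set.univ = μ.real Set.univ - μ.real S := by
    rw [measureReal_restrict_apply_univ, measureReal_compl hS]
  have hfin := lintegral_weight_mul_exp_logPotential_lt_top (μ.restrict Sᶜ)
    (s := p * μ.real S) hp.le (by rw [hcompl]; exact hn1) (by rw [hcompl]; linarith)
  set C : ℝ := (4 * (1 + A)) ^ (p * μ.real S) with hC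
  refine ⟨2 * A, ?_⟩
  have hae : ∀ᵐ x : ℝ, x ∈ {x : ℝ | 2 * A < |x|} →
      ENNReal.ofReal (Real.exp (p * logPotential μ x)) ≤ ENNReal.ofReal C *
      ENNReal.ofReal ((1 + |x|) ^ (-(p * μ.real S)) *
        Real.exp (p * logPotential (μ.restrict Sᶜ) x)) := by
    filter_upwards [ae_integrable_logKernel μ] with x hx hxb
    have hle : logPotential (μ.restrict S) x ≤
        μ.real S * Real.log (4 * (1 + A) / (1 + |x|)) := by
      refine logPotential_restrict_le hS hx fun t ht => ?_
      have ht' : |t| ≤ A := by simpa [hSdef, Real.dist_eq] using ht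
      have h1 : (1 + |x|) / 4 ≤ ‖(t : ℂ) - (x : ℂ)‖ := by
        rw [← Complex.ofReal_sub, Complex.norm_real, Real.norm_eq_abs, abs_sub_comm]
        have := abs_sub_abs_le_abs_sub x t
        linarith
      have h2 : 0 < (1 + |x|) / 4 := by positivity
      unfold logKernel
      refine Real.log_le_log (div_pos (sqrt_one_add_sq_pos t) (h2.trans_le h1)) ?_
      calc Real.sqrt (1 + t ^ 2) / ‖(t : ℂ) - (x : ℂ)‖ ≤ (1 + A) / ((1 + |x|) / 4) := by
            gcongr
            exact (sqrt_one_add_sq_le t).trans (by linarith)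
        _ = _ := by field_simp
    rw [← ENNReal.ofReal_mul (by positivity)]
    refine ENNReal.ofReal_le_ofReal ?_
    rw [← logPotential_restrict_add_compl hS hx, mul_add, Real.exp_add, ← mul_assoc]
    gcongr
    calc Real.exp (p * logPotential (μ.restrict S) x)
        ≤ Real.exp (p * (μ.real S * Real.log (4 * (1 + A) / (1 + |x|)))) := by gcongr
      _ = (4 * (1 + A) / (1 + |x|)) ^ (p * μ.real S) := by
          rw [Real.rpow_def_of_pos (by positivity)]; congr 1; ring
      _ = _ := by
          rw [Real.div_rpow (by positivity) (by positivity), Real.rpow_neg (by positivity),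
            div_eq_mul_inv]
  have hms : MeasurableSet {x : ℝ | 2 * A < |x|} :=
    measurableSet_lt measurable_const (by fun_prop)
  refine (setLIntegral_mono_ae' hms hae).trans_lt ?_
  rw [lintegral_const_mul' _ _ (by simp)]
  exact ENNReal.mul_lt_top (by simp) ((setLIntegral_le_lintegral _ _).trans_lt hfin)

theorem lintegral_exp_logPotential_lt_top (μ : Measure ℝ) [IsFiniteMeasure μ]
    {p : ℝ} (hp : 0 < p) (h : 1 < p * μ.real Set.univ)
    (hatom : ∀ x, μ {x} < ENNReal.ofReal (1 / p)) :
    ∫⁻ x : ℝ, ENNReal.ofReal (Real.exp (p * logPotential μ x)) < ⊤ := by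
  obtain ⟨R, hR⟩ := exists_lintegral_tail_exp_logPotential_lt_top μ hp h
  set g : ℝ → ℝ≥0∞ := fun x => ENNReal.ofReal (Real.exp (p * logPotential μ x)) with hg
  -- As a measure with density, local finiteness passes to compact sets.
  have hcpt : volume.withDensity g (Metric.closedBall (0 : ℝ) R) < ⊤ := by
    refine (isCompact_closedBall 0 R).measure_lt_top_of_nhdsWithin fun x _ => ?_
    obtain ⟨δ, hδ, hfin⟩ := exists_lintegral_ball_exp_logPotential_lt_top μ hp (hatom x)
    refine ⟨Metric.ball x δ, mem_nhdsWithin_of_mem_nhds (Metric.ball_mem_nhds x hδ), ?_⟩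
    rwa [withDensity_apply _ measurableSet_ball]
  rw [withDensity_apply _ measurableSet_closedBall] at hcpt
  have hcompl : (Metric.closedBall (0 : ℝ) R)ᶜ = {x : ℝ | R < |x|} := by
    ext x; simp
  rw [← lintegral_add_compl g (measurableSet_closedBall (x := (0 : ℝ)) (ε := R)), hcompl]
  exact ENNReal.add_lt_top.2 ⟨hcpt, hR⟩

theorem lintegral_exp_neg_logPotential_eq_top (μ : Measure ℝ) [IsFiniteMeasure μ]
    {p : ℝ} (hp : 0 < p) (h : 1 < p * μ.real Set.univ) :
    ∫⁻ x : ℝ, ENNReal.ofReal (Real.exp (-(p * logPotential μ x)) / (1 + x ^ 2)) = ⊤ := by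
  obtain ⟨R, hR⟩ := exists_lintegral_tail_exp_logPotential_lt_top μ hp h
  by_contra hne
  set T : ℝ := max R 1
  have hmeas := measurable_logPotential μ
  have hinv : ∫⁻ x in Set.Ioi T, ENNReal.ofReal (x⁻¹ / 2) < ⊤ := by
    calc ∫⁻ x in Set.Ioi T, ENNReal.ofReal (x⁻¹ / 2)
        ≤ ∫⁻ x in Set.Ioi T, (ENNReal.ofReal (Real.exp (p * logPotential μ x)) +
          ENNReal.ofReal (Real.exp (-(p * logPotential μ x)) / (1 + x ^ 2))) := by
          refine setLIntegral_mono' measurableSet_Ioi fun x hx => ?_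
          have hx1 : 1 < x := (le_max_right _ _).trans_lt hx
          rw [← ENNReal.ofReal_add (by positivity) (by positivity)]
          refine ENNReal.ofReal_le_ofReal ?_
          set a := Real.exp (p * logPotential μ x)
          have ha : 0 < a := Real.exp_pos _
          rw [Real.exp_neg]
          -- AM-GM: the product of the two summands is `1 / (1 + x²)`, which is at least `(1 /
          -- (2x))²` because `x > 1`.
          refine le_of_sq_le_sq ?_ (by positivity)
          have h1 : (x⁻¹ / 2) ^ 2 ≤ 1 / (1 + x ^ 2) := by
            rw [div_pow, inv_pow, le_div_iff₀ (by positivity)]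
            field_simp
            nlinarith
          have h2 : a * (a⁻¹ / (1 + x ^ 2)) = 1 / (1 + x ^ 2) := by field_simp
          have h3 : 0 ≤ a⁻¹ / (1 + x ^ 2) := by positivity
          nlinarith [mul_nonneg ha.le h3]
      _ ≤ (∫⁻ x in Set.Ioi T, ENNReal.ofReal (Real.exp (p * logPotential μ x))) +
          ∫⁻ x in Set.Ioi T, ENNReal.ofReal (Real.exp (-(p * logPotential μ x)) / (1 + x ^ 2)) :=
          (lintegral_add_left (by fun_prop) _).le
      _ < ⊤ := by
          refine ENNReal.add_lt_top.2 ⟨(lintegral_mono_set fun x hx => ?_).trans_lt hR,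
            (setLIntegral_le_lintegral _ _).trans_lt (lt_top_iff_ne_top.2 hne)⟩
          exact ((le_max_left _ _).trans_lt hx).trans_le (le_abs_self x)
  refine not_integrableOn_Ioi_inv (a := T) ?_
  have hi : IntegrableOn (fun x : ℝ => x⁻¹ / 2) (Set.Ioi T) := by
    refine ⟨by fun_prop, ?_⟩
    rw [hasFiniteIntegral_iff_ofReal]
    · exact hinv
    · refine (ae_restrict_iff' measurableSet_Ioi).2 (ae_of_all _ fun x hx => ?_)
      have : 0 < x := by linarith [Set.mem_Ioi.1 hx, le_max_right R 1]
      positivity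
  have := hi.const_mul 2
  simpa [IntegrableOn, mul_div_cancel₀] using this

/-! ### Dependence on the height and boundary values -/

theorem norm_sub_lt_norm_sub {x y₁ y₂ : ℝ} (h1 : 0 ≤ y₁) (h : y₁ < y₂) (t : ℝ) :
    ‖(t : ℂ) - (x + y₁ * Complex.I)‖ < ‖(t : ℂ) - (x + y₂ * Complex.I)‖ := by
  rw [← sq_lt_sq₀ (norm_nonneg _) (norm_nonneg _), Complex.sq_norm, Complex.sq_norm,
    Complex.normSq_apply, Complex.normSq_apply]
  simp
  nlinarith

theorem logKernel_lt_logKernel {x y₁ y₂ t : ℝ} (h1 : 0 ≤ y₁) (h : y₁ < y₂)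
    (hpos : 0 < ‖(t : ℂ) - (x + y₁ * Complex.I)‖) :
    logKernel (x + y₂ * Complex.I) t < logKernel (x + y₁ * Complex.I) t := by
  have hlt := norm_sub_lt_norm_sub (x := x) h1 h t
  have hs := sqrt_one_add_sq_pos t
  unfold logKernel
  refine Real.log_lt_log (div_pos hs (hpos.trans hlt)) ?_
  gcongr

/-- Allowing `y₁ = 0` covers boundary values. Then `hpos` excludes an atom at `x`, where the kernel
would take its default value `0` instead of `+∞`. -/
theorem logPotential_lt_logPotential {μ : Measure ℝ} (hμ : μ ≠ 0) {x y₁ y₂ : ℝ} (h1 : 0 ≤ y₁)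
    (h : y₁ < y₂) (hpos : ∀ᵐ t : ℝ ∂μ, 0 < ‖(t : ℂ) - (x + y₁ * Complex.I)‖)
    (hi1 : Integrable (logKernel (x + y₁ * Complex.I)) μ)
    (hi2 : Integrable (logKernel (x + y₂ * Complex.I)) μ) :
    logPotential μ (x + y₂ * Complex.I) < logPotential μ (x + y₁ * Complex.I) := by
  have hlt : ∀ᵐ t ∂μ, 0 < logKernel (x + y₁ * Complex.I) t - logKernel (x + y₂ * Complex.I) t := by
    filter_upwards [hpos] with t ht
    exact sub_pos.2 (logKernel_lt_logKernel h1 h ht)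
  rw [← sub_pos, logPotential, logPotential, ← integral_sub hi1 hi2]
  rw [integral_pos_iff_support_of_nonneg_ae (hlt.mono fun t ht => ht.le) (hi1.sub hi2)]
  rw [pos_iff_ne_zero]
  intro h0
  have : ∀ᵐ t ∂μ, False := by
    have h0' : ∀ᵐ t ∂μ, t ∉ Function.support
      (fun t : ℝ => logKernel (x + y₁ * Complex.I) t - logKernel (x + y₂ * Complex.I) t) :=
      measure_eq_zero_iff_ae_notMem.1 h0
    filter_upwards [hlt, h0'] with t ht ht'
    exact ht' ht.ne'
  exact hμ (by simpa [ae_iff] using this)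

theorem norm_ofReal_sub_pos_of_im_pos {z : ℂ} (hz : 0 < z.im) (t : ℝ) : 0 < ‖(t : ℂ) - z‖ :=
  hz.trans_le (im_le_norm_ofReal_sub z t)

theorem ae_ne_of_measure_singleton {μ : Measure ℝ} {x : ℝ} (h : μ {x} = 0) : ∀ᵐ t ∂μ, t ≠ x :=
  measure_eq_zero_iff_ae_notMem.1 h

/-- In the cone `|t - x| ≤ (2 + κ) |t - z|`, so the kernel at `z` exceeds the one at `x` by at most
`log (2 + κ)`; with the uniform lower bound this permits dominated convergence. -/
theorem tendsto_logPotential_cone {μ : Measure ℝ} [IsFiniteMeasure μ] {x : ℝ}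
    (hx : Integrable (logKernel x) μ) (h0 : μ {x} = 0) {κ : ℝ} (hκ : 0 < κ) :
    Tendsto (logPotential μ) (𝓝[{z : ℂ | 0 < z.im ∧ |z.re - x| ≤ κ * z.im}] (x : ℂ))
      (𝓝 (logPotential μ x)) := by
  refine tendsto_integral_filter_of_dominated_convergence
    (fun t => |logKernel x t| + Real.log (2 + κ) + Real.log (2 + |x|)) ?_ ?_ ?_ ?_
  · exact Eventually.of_forall fun z => (measurable_logKernel z).aestronglyMeasurable
  · have hball : ∀ᶠ z in 𝓝[{z : ℂ | 0 < z.im ∧ |z.re - x| ≤ κ * z.im}] (x : ℂ),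
        z ∈ Metric.ball (x : ℂ) 1 :=
      mem_nhdsWithin_of_mem_nhds (Metric.ball_mem_nhds _ one_pos)
    filter_upwards [hball, self_mem_nhdsWithin] with z hz1 ⟨hz2, hz3⟩
    filter_upwards [ae_ne_of_measure_singleton h0] with t ht
    rw [Metric.mem_ball, Complex.dist_eq] at hz1
    have hzn : ‖z‖ ≤ 1 + |x| := by
      have := norm_sub_norm_le z x
      rw [Complex.norm_real, Real.norm_eq_abs] at this
      linarith
    have hpos := norm_ofReal_sub_pos_of_im_pos hz2 t
    have hposx : 0 < ‖(t : ℂ) - (x : ℂ)‖ :=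
      norm_pos_iff.2 (sub_ne_zero.2 (by exact_mod_cast ht))
    have hdist : ‖(t : ℂ) - (x : ℂ)‖ ≤ (2 + κ) * ‖(t : ℂ) - z‖ := by
      have e1 := norm_sub_le_norm_sub_add_norm_sub (t : ℂ) z x
      have e2 := Complex.norm_le_abs_re_add_abs_im (z - x)
      simp only [Complex.sub_re, Complex.ofReal_re, Complex.sub_im, Complex.ofReal_im, sub_zero,
        abs_of_pos hz2] at e2
      nlinarith [im_le_norm_ofReal_sub z t]
    have hup : logKernel z t ≤ logKernel x t + Real.log (2 + κ) := by
      unfold logKernel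
      have hs := sqrt_one_add_sq_pos t
      rw [← Real.log_mul (by positivity) (by positivity)]
      refine Real.log_le_log (by positivity) ?_
      rw [div_mul_eq_mul_div, div_le_div_iff₀ hpos hposx, mul_assoc]
      gcongr
    have hlow := neg_log_le_logKernel z t
    have hlog : Real.log (1 + ‖z‖) ≤ Real.log (2 + |x|) :=
      Real.log_le_log (by positivity) (by linarith)
    have p1 : 0 ≤ Real.log (2 + κ) := Real.log_nonneg (by linarith)
    have p2 : 0 ≤ Real.log (2 + |x|) := Real.log_nonneg (by linarith [abs_nonneg x])
    rw [Real.norm_eq_abs, abs_le]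
    constructor
    · linarith [abs_nonneg (logKernel x t)]
    · linarith [le_abs_self (logKernel x t)]
  · exact (hx.abs.add (integrable_const _)).add (integrable_const _)
  · filter_upwards [ae_ne_of_measure_singleton h0] with t ht
    have hne : ‖(t : ℂ) - (x : ℂ)‖ ≠ 0 :=
      norm_ne_zero_iff.2 (sub_ne_zero.2 (by exact_mod_cast ht))
    have hs := sqrt_one_add_sq_pos t
    have : ContinuousAt (fun z : ℂ => logKernel z t) (x : ℂ) := by
      unfold logKernel
      refine ContinuousAt.log (ContinuousAt.div (by fun_prop) (by fun_prop) hne) ?_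
      positivity
    exact this.tendsto.mono_left nhdsWithin_le_nhds

/-- The boundary values of the imaginary part of the kernel `log (√(1+t²)/(t-z))`. -/
def boundaryArg (x t : ℝ) : ℝ := if t < x then Real.pi else if t = x then Real.pi / 2 else 0

theorem measurable_boundaryArg (x : ℝ) : Measurable (boundaryArg x) :=
  Measurable.ite measurableSet_Iio measurable_const
    (Measurable.ite (measurableSet_singleton x) measurable_const measurable_const)

theorem boundaryArg_nonneg (x t : ℝ) : 0 ≤ boundaryArg x t := by
  unfold boundaryArg
  have := Real.pi_pos
  split_ifs <;> linarith

theorem boundaryArg_le_pi (x t : ℝ) : boundaryArg x t ≤ Real.pi := by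
  unfold boundaryArg
  have := Real.pi_pos
  split_ifs <;> linarith

theorem integrable_boundaryArg (μ : Measure ℝ) [IsFiniteMeasure μ] (x : ℝ) :
    Integrable (boundaryArg x) μ :=
  Integrable.of_bound (measurable_boundaryArg x).aestronglyMeasurable Real.pi
    (ae_of_all _ fun t => by
      rw [Real.norm_eq_abs, abs_of_nonneg (boundaryArg_nonneg x t)]
      exact boundaryArg_le_pi x t)

theorem indicator_Icc_le_boundaryArg_sub {x y : ℝ} (hxy : x < y) (t : ℝ) :
    (Set.Icc x y).indicator (fun _ => Real.pi / 2) t ≤ boundaryArg y t - boundaryArg x t := by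
  have := Real.pi_pos
  unfold boundaryArg Set.indicator
  simp only [Set.mem_Icc]
  split_ifs <;> grind

theorem ofReal_sub_add_mul_I_im (t x y : ℝ) : ((t : ℂ) - (x + y * Complex.I)).im = -y := by
  simp

theorem arg_sqrt_div (t : ℝ) (w : ℂ) :
    Complex.arg (((Real.sqrt (1 + t ^ 2) : ℝ) : ℂ) / w) = Complex.arg w⁻¹ := by
  rw [div_eq_mul_inv, Complex.arg_real_mul _ (sqrt_one_add_sq_pos t)]

theorem tendsto_vertical (x : ℝ) :
    Tendsto (fun y : ℝ => (x : ℂ) + y * Complex.I) (𝓝[>] 0) (𝓝 x) := by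
  have : Continuous fun y : ℝ => (x : ℂ) + y * Complex.I := by fun_prop
  have h := this.tendsto 0
  simp only [Complex.ofReal_zero, zero_mul, add_zero] at h
  exact h.mono_left nhdsWithin_le_nhds

theorem tendsto_arg_inv_vertical (x t : ℝ) :
    Tendsto (fun y : ℝ => Complex.arg ((t : ℂ) - (x + y * Complex.I))⁻¹) (𝓝[>] 0)
      (𝓝 (boundaryArg x t)) := by
  have hlim : t ≠ x → Tendsto (fun y : ℝ => ((t : ℂ) - (x + y * Complex.I))⁻¹) (𝓝[>] 0)
      (𝓝 (((t - x)⁻¹ : ℝ) : ℂ)) := by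
    intro hne
    have := ((tendsto_vertical x).const_sub (t : ℂ)).inv₀
      (sub_ne_zero.2 (by exact_mod_cast hne))
    simpa using this
  rcases lt_trichotomy t x with h | h | h
  · have hneg : (t - x)⁻¹ < 0 := inv_lt_zero.2 (by linarith)
    -- The limit lies on the branch cut of `arg`; approach from `Im ≥ 0` selects the value `π`.
    have harg := Complex.tendsto_arg_nhdsWithin_im_nonneg_of_re_neg_of_im_zero
      (z := (((t - x)⁻¹ : ℝ) : ℂ)) (by rwa [Complex.ofReal_re]) (Complex.ofReal_im _)
    rw [boundaryArg, if_pos h]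
    refine harg.comp (tendsto_nhdsWithin_iff.2 ⟨hlim h.ne, ?_⟩)
    filter_upwards [self_mem_nhdsWithin] with y hy
    have hy' : (0 : ℝ) < y := hy
    change 0 ≤ (((t : ℂ) - (x + y * Complex.I))⁻¹).im
    rw [Complex.inv_im, ofReal_sub_add_mul_I_im, neg_neg]
    exact div_nonneg hy'.le (Complex.normSq_nonneg _)
  · rw [boundaryArg, if_neg h.not_lt, if_pos h]
    refine tendsto_const_nhds.congr' ?_
    filter_upwards [self_mem_nhdsWithin] with y hy
    have hy' : (0 : ℝ) < y⁻¹ := inv_pos.2 hy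
    have : ((t : ℂ) - (x + y * Complex.I))⁻¹ = ((y⁻¹ : ℝ) : ℂ) * Complex.I := by
      rw [h, sub_add_cancel_left, inv_neg, mul_inv, Complex.inv_I]
      push_cast
      ring
    rw [this, Complex.arg_real_mul _ hy', Complex.arg_I]
  · have hpos : 0 < (t - x)⁻¹ := inv_pos.2 (by linarith)
    rw [boundaryArg, if_neg h.not_gt, if_neg h.ne']
    have hc := (Complex.continuousAt_arg (Complex.ofReal_mem_slitPlane.2 hpos)).tendsto
    rw [Complex.arg_ofReal_of_nonneg hpos.le] at hc
    exact hc.comp (hlim h.ne')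

theorem integrable_log_kernel (μ : Measure ℝ) [IsFiniteMeasure μ] {z : ℂ} (hz : 0 < z.im) :
    Integrable (fun t : ℝ =>
      Complex.log (((Real.sqrt (1 + t ^ 2) : ℝ) : ℂ) / ((t : ℂ) - z))) μ := by
  have hm : Measurable fun t : ℝ =>
      Complex.log (((Real.sqrt (1 + t ^ 2) : ℝ) : ℂ) / ((t : ℂ) - z)) :=
    Complex.measurable_log.comp (by fun_prop)
  refine ((integrable_logKernel hz μ).abs.add (integrable_const Real.pi)).mono'
    hm.aestronglyMeasurable (ae_of_all _ fun t => ?_)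
  refine (Complex.norm_le_abs_re_add_abs_im _).trans ?_
  rw [Complex.log_re, Complex.log_im, norm_div, Complex.norm_real, Real.norm_eq_abs,
    abs_of_pos (sqrt_one_add_sq_pos t)]
  exact add_le_add le_rfl (Complex.abs_arg_le_pi _)

theorem re_integral_log_kernel (μ : Measure ℝ) [IsFiniteMeasure μ] {z : ℂ} (hz : 0 < z.im) :
    (∫ t : ℝ, Complex.log (((Real.sqrt (1 + t ^ 2) : ℝ) : ℂ) / (t - z)) ∂μ).re =
      logPotential μ z := by
  refine (Complex.reCLM.integral_comp_comm (integrable_log_kernel μ hz)).symm.trans ?_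
  refine integral_congr_ae (ae_of_all _ fun t => ?_)
  simp only [Complex.reCLM_apply]
  rw [Complex.log_re, norm_div, Complex.norm_real, Real.norm_eq_abs,
    abs_of_pos (sqrt_one_add_sq_pos t), logKernel]

theorem im_integral_log_kernel (μ : Measure ℝ) [IsFiniteMeasure μ] {z : ℂ} (hz : 0 < z.im) :
    (∫ t : ℝ, Complex.log (((Real.sqrt (1 + t ^ 2) : ℝ) : ℂ) / (t - z)) ∂μ).im =
      ∫ t : ℝ, Complex.arg ((t : ℂ) - z)⁻¹ ∂μ := by
  refine (Complex.imCLM.integral_comp_comm (integrable_log_kernel μ hz)).symm.trans ?_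
  refine integral_congr_ae (ae_of_all _ fun t => ?_)
  simp only [Complex.imCLM_apply]
  rw [Complex.log_im, arg_sqrt_div]

theorem tendsto_integral_arg_inv_vertical (μ : Measure ℝ) [IsFiniteMeasure μ] (x : ℝ) :
    Tendsto (fun y : ℝ => ∫ t : ℝ, Complex.arg ((t : ℂ) - (x + y * Complex.I))⁻¹ ∂μ) (𝓝[>] 0)
      (𝓝 (∫ t, boundaryArg x t ∂μ)) := by
  refine tendsto_integral_filter_of_dominated_convergence (fun _ => Real.pi) ?_ ?_
    (integrable_const _) (ae_of_all _ fun t => tendsto_arg_inv_vertical x t)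
  · exact Eventually.of_forall fun y =>
      (Complex.measurable_arg.comp (by fun_prop)).aestronglyMeasurable
  · exact Eventually.of_forall fun y => ae_of_all _ fun t =>
      (Real.norm_eq_abs _).trans_le (Complex.abs_arg_le_pi _)

/-! ### The canonical representation -/

/-- The right-continuous version of `ν` lies between `ν x` and `ν (x + 1)`, so it keeps the limit
`c` at `-∞` and the bound `1`; hence the mass is at most `1 - c`. -/
theorem IsReprMeasure.exists_formula {f : ℂ → ℂ} {μ : Measure ℝ} (hμ : IsReprMeasure f μ) :
    IsFiniteMeasure μ ∧ ∃ c β : ℝ, 0 ≤ c ∧ c + μ.real Set.univ ≤ 1 ∧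
      ∀ z : ℂ, 0 < z.im → f z = β + Complex.I * Real.pi * c +
        ∫ t : ℝ, Complex.log (((Real.sqrt (1 + t ^ 2) : ℝ) : ℂ) / (t - z)) ∂μ := by
  obtain ⟨ν, hν, c, β, hbd, hc, rfl, hf⟩ := hμ
  have hlow : ∀ x, ν x ≤ hν.stieltjesFunction x := fun x => by
    rw [hν.stieltjesFunction_eq]; exact hν.le_rightLim le_rfl
  have hup : ∀ x, hν.stieltjesFunction x ≤ ν (x + 1) := fun x => by
    rw [hν.stieltjesFunction_eq]; exact hν.rightLim_le (lt_add_one x)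
  have hbot : Tendsto hν.stieltjesFunction atBot (𝓝 c) :=
    tendsto_of_tendsto_of_tendsto_of_le_of_le hc
      (hc.comp (tendsto_atBot_add_const_right _ _ tendsto_id)) hlow hup
  have htop : Tendsto hν.stieltjesFunction atTop (𝓝 (⨆ x, hν.stieltjesFunction x)) :=
    tendsto_atTop_ciSup hν.stieltjesFunction.mono
      ⟨1, by rintro _ ⟨x, rfl⟩; exact (hup x).trans (hbd _).2⟩
  set u := ⨆ x, hν.stieltjesFunction x
  have huniv := hν.stieltjesFunction.measure_univ hbot htop
  have hc0 : 0 ≤ c := ge_of_tendsto' hc fun x => (hbd x).1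
  have hu1 : u ≤ 1 := le_of_tendsto' htop fun x => (hup x).trans (hbd _).2
  have hcu : c ≤ u := by
    refine (le_of_tendsto hbot ?_ : c ≤ hν.stieltjesFunction 0).trans
      (hν.stieltjesFunction.mono.ge_of_tendsto htop 0)
    filter_upwards [eventually_le_atBot 0] with x hx
    exact hν.stieltjesFunction.mono hx
  refine ⟨⟨by rw [huniv]; exact ENNReal.ofReal_lt_top⟩, c, β, hc0, ?_, hf⟩
  rw [measureReal_def, huniv, ENNReal.toReal_ofReal (by linarith)]
  linarith

theorem measure_Icc_eq_zero_of_integral_boundaryArg_eq {μ : Measure ℝ} [IsFiniteMeasure μ]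
    {x y : ℝ} (hxy : x < y) (h : ∫ t, boundaryArg x t ∂μ = ∫ t, boundaryArg y t ∂μ) :
    μ (Set.Icc x y) = 0 := by
  have hi := integrable_boundaryArg μ
  have h1 : ∫ t, (Set.Icc x y).indicator (fun _ => Real.pi / 2) t ∂μ ≤
      ∫ t, (boundaryArg y t - boundaryArg x t) ∂μ :=
    integral_mono ((integrable_const _).indicator measurableSet_Icc) ((hi y).sub (hi x))
      fun t => indicator_Icc_le_boundaryArg_sub hxy t
  rw [integral_sub (hi y) (hi x), h, sub_self, integral_indicator_const _ measurableSet_Icc,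
    smul_eq_mul] at h1
  have h2 : μ.real (Set.Icc x y) ≤ 0 := by
    by_contra! hpos
    nlinarith [mul_pos hpos Real.pi_pos]
  exact (measureReal_eq_zero_iff (measure_ne_top _ _)).1 (le_antisymm h2 measureReal_nonneg)

/-- Vertical limits of imaginary parts give `∫ boundaryArg x t ∂μ` as a function of `x` that is
constant on each side of `a`, so `μ` vanishes on closed intervals missing `a`. -/
theorem IsReprMeasure.support_subsingleton_of_elementary {f : ℂ → ℂ} {μ : Measure ℝ}
    (hμ : IsReprMeasure f μ) (hf : f ∈ Elementary) : μ.support.Subsingleton := by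
  obtain ⟨hfin, c, β, -, -, hrep⟩ := hμ.exists_formula
  obtain ⟨⟨θ, -, θ₁, -, a, β', hel⟩, -⟩ := hf
  have him : ∀ x y : ℝ, 0 < y → Real.pi * c +
      ∫ t : ℝ, Complex.arg ((t : ℂ) - (x + y * Complex.I))⁻¹ ∂μ =
      Real.pi * θ₁ * (1 - θ) + θ * Complex.arg ((a : ℂ) - (x + y * Complex.I))⁻¹ := by
    intro x y hy
    have hz : 0 < ((x : ℂ) + y * Complex.I).im := by simpa using hy
    have h := congrArg Complex.im ((hrep _ hz).symm.trans (hel _ hz))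
    rw [Complex.add_im, im_integral_log_kernel μ hz, one_div, Complex.add_im (_ + _) (_ * _),
      Complex.im_ofReal_mul, Complex.log_im] at h
    simpa using h
  have hlim : ∀ x : ℝ, Real.pi * c + ∫ t, boundaryArg x t ∂μ =
      Real.pi * θ₁ * (1 - θ) + θ * boundaryArg x a := by
    intro x
    refine tendsto_nhds_unique ((tendsto_integral_arg_inv_vertical μ x).const_add (Real.pi * c))
      ((((tendsto_arg_inv_vertical x a).const_mul θ).const_add
        (Real.pi * θ₁ * (1 - θ))).congr' ?_)
    filter_upwards [self_mem_nhdsWithin] with y hy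
    exact (him x y hy).symm
  suffices h : ∀ s ∈ μ.support, s = a from fun s hs t ht => (h s hs).trans (h t ht).symm
  intro s hs
  rw [Measure.mem_support_iff_forall] at hs
  by_contra hne
  have key : ∀ x y : ℝ, x < y → boundaryArg x a = boundaryArg y a → Set.Icc x y ∈ 𝓝 s → False := by
    intro x y hxy hb hmem
    refine (hs _ hmem).ne' (measure_Icc_eq_zero_of_integral_boundaryArg_eq hxy ?_)
    have e1 := hlim x
    have e2 := hlim y
    rw [hb] at e1
    linarith
  rcases lt_or_gt_of_ne hne with h | h
  · refine key (s - 1) ((s + a) / 2) (by linarith) ?_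
      (Icc_mem_nhds (by linarith) (by linarith))
    unfold boundaryArg
    grind
  · refine key ((s + a) / 2) (s + 1) (by linarith) ?_
      (Icc_mem_nhds (by linarith) (by linarith))
    unfold boundaryArg
    grind

theorem IsReprMeasure.elementary_of_support_subsingleton {f : ℂ → ℂ} {μ : Measure ℝ}
    (hμ : IsReprMeasure f μ) (hsymm : ∀ z : ℂ, z.im < 0 → f z = conj (f (conj z)))
    (h : μ.support.Subsingleton) : f ∈ Elementary := by
  obtain ⟨hfin, c, β, hc, hc1, hrep⟩ := hμ.exists_formula
  have hexists : ∃ a, μ.support ⊆ {a} := by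
    rcases h.eq_empty_or_singleton with h | ⟨a, h⟩
    · exact ⟨0, by simp [h]⟩
    · exact ⟨a, h.subset⟩
  obtain ⟨a, ha⟩ := hexists
  have hae : ∀ᵐ t ∂μ, t = a := by
    have h0 : ∀ᵐ t ∂μ, t ∉ μ.supportᶜ := measure_eq_zero_iff_ae_notMem.1 μ.measure_compl_support
    filter_upwards [h0] with t ht
    exact ha (not_not.1 ht)
  set θ := μ.real Set.univ
  have hθ : 0 ≤ θ := measureReal_nonneg
  set r := Real.sqrt (1 + a ^ 2)
  have hr : 0 < r := sqrt_one_add_sq_pos a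
  have hint : ∀ z : ℂ, 0 < z.im →
      ∫ t : ℝ, Complex.log (((Real.sqrt (1 + t ^ 2) : ℝ) : ℂ) / (t - z)) ∂μ =
      θ * (Real.log r + Complex.log (1 / (a - z))) := by
    intro z hz
    have hne : ((a : ℂ) - z) ≠ 0 := norm_pos_iff.1 (norm_ofReal_sub_pos_of_im_pos hz a)
    rw [integral_congr_ae (g := fun _ => Complex.log ((r : ℂ) / (a - z)))
      (hae.mono fun t ht => by simp only [ht, r]), integral_const,
      div_eq_mul_one_div, Complex.log_ofReal_mul hr (one_div_ne_zero hne)]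
    simp [θ, mul_add]
  -- Solves `θ₁ (1 - θ) = c`, with `θ₁ ≤ 1` since `c + θ ≤ 1`. If `θ = 1` then `c = 0`, and division
  -- by zero returns an admissible `0`.
  refine ⟨⟨θ, ⟨hθ, by linarith⟩, c / (1 - θ), ⟨div_nonneg hc (by linarith),
    div_le_one_of_le₀ (by linarith) (by linarith)⟩, a, β + θ * Real.log r, fun z hz => ?_⟩, hsymm⟩
  have hcθ : (c : ℂ) = ((c / (1 - θ) : ℝ) : ℂ) * (1 - θ) := by
    rcases eq_or_ne (1 - θ) 0 with h0 | h0
    · have : c = 0 := by linarith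
      simp [this]
    · exact_mod_cast (div_mul_cancel₀ c h0).symm
  rw [hrep z hz, hint z hz, mul_assoc, hcθ]
  push_cast
  ring

/-! ### Atoms and boundary values -/

/-- Every point misses one of two disjoint open sets of positive mass, so one bound strictly below
the total mass serves all atoms and survives the supremum. -/
theorem maxAtom_lt_measure_univ {μ : Measure ℝ} [IsFiniteMeasure μ] (h : μ.support.Nontrivial) :
    maxAtom μ Set.univ < μ Set.univ := by
  obtain ⟨a, ha, b, hb, hab⟩ := h
  obtain ⟨U, V, hU, hV, haU, hbV, hdisj⟩ := t2_separation hab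
  rw [Measure.mem_support_iff_forall] at ha hb
  have hlt : ∀ W : Set ℝ, IsOpen W → 0 < μ W → μ Wᶜ < μ Set.univ := by
    intro W hW hpos
    rw [measure_compl hW.measurableSet (measure_ne_top _ _)]
    exact ENNReal.sub_lt_self (measure_ne_top _ _) (hpos.trans_le (measure_mono W.subset_univ)).ne'
      hpos.ne'
  refine (iSup₂_le fun x _ => ?_ : maxAtom μ Set.univ ≤ max (μ Uᶜ) (μ Vᶜ)).trans_lt
    (max_lt (hlt U hU (ha U (hU.mem_nhds haU))) (hlt V hV (hb V (hV.mem_nhds hbV))))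
  by_cases hx : x ∈ U
  · exact le_max_of_le_right (measure_mono (Set.singleton_subset_iff.2
      (Set.disjoint_left.1 hdisj hx)))
  · exact le_max_of_le_left (measure_mono (Set.singleton_subset_iff.2 hx))

theorem HasNontangentialReLimit.unique {f : ℂ → ℂ} {x u v : ℝ}
    (hu : HasNontangentialReLimit f x u) (hv : HasNontangentialReLimit f x v) : u = v := by
  have hcone : Tendsto (fun y : ℝ => (x : ℂ) + y * Complex.I) (𝓝[>] 0)
      (𝓝[{z : ℂ | 0 < z.im ∧ |z.re - x| ≤ 1 * z.im}] (x : ℂ)) := by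
    refine tendsto_nhdsWithin_iff.2 ⟨tendsto_vertical x, ?_⟩
    filter_upwards [self_mem_nhdsWithin] with y hy
    have hy' : (0 : ℝ) < y := hy
    simp [hy', hy'.le]
  exact tendsto_nhds_unique ((hu 1 one_pos).comp hcone) ((hv 1 one_pos).comp hcone)

theorem HasNontangentialReLimit.bdryU_eq {f : ℂ → ℂ} {x u : ℝ}
    (hu : HasNontangentialReLimit f x u) : bdryU f x = u := by
  have h : ∃ u, HasNontangentialReLimit f x u := ⟨u, hu⟩
  rw [bdryU, dif_pos h]
  exact h.choose_spec.unique hu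

theorem hasNontangentialReLimit_of_re_eq {f : ℂ → ℂ} {μ : Measure ℝ} [IsFiniteMeasure μ] {β : ℝ}
    (hre : ∀ z : ℂ, 0 < z.im → (f z).re = β + logPotential μ z) {x : ℝ}
    (hx : Integrable (logKernel x) μ) (h0 : μ {x} = 0) :
    HasNontangentialReLimit f x (β + logPotential μ x) := by
  intro κ hκ
  refine ((tendsto_logPotential_cone hx h0 hκ).const_add β).congr' ?_
  filter_upwards [self_mem_nhdsWithin] with z hz
  exact (hre z hz.1).symm

theorem IsReprMeasure.support_nontrivial_iff {f : ℂ → ℂ} {μ : Measure ℝ} (hμ : IsReprMeasure f μ)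
    (hsymm : ∀ z : ℂ, z.im < 0 → f z = conj (f (conj z))) :
    μ.support.Nontrivial ↔ f ∉ Elementary := by
  rw [← Set.not_subsingleton_iff, not_iff_not]
  exact ⟨hμ.elementary_of_support_subsingleton hsymm, hμ.support_subsingleton_of_elementary⟩

theorem lintegral_exp_lt_lintegral_exp {u v : ℝ → ℝ} {p : ℝ} (hp : 0 < p)
    (hv : AEMeasurable v) (huv : ∀ᵐ x, u x < v x)
    (hfin : ∫⁻ x : ℝ, ENNReal.ofReal (Real.exp (p * v x)) < ⊤) :
    ∫⁻ x : ℝ, ENNReal.ofReal (Real.exp (p * u x)) <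
      ∫⁻ x : ℝ, ENNReal.ofReal (Real.exp (p * v x)) := by
  have hlt : ∀ᵐ x : ℝ,
      ENNReal.ofReal (Real.exp (p * u x)) < ENNReal.ofReal (Real.exp (p * v x)) := by
    filter_upwards [huv] with x hx
    refine (ENNReal.ofReal_lt_ofReal_iff (Real.exp_pos _)).2 ?_
    gcongr
  refine lintegral_strict_mono (NeZero.ne _) (by fun_prop) ?_ hlt
  exact ((lintegral_mono_ae (hlt.mono fun x hx => hx.le)).trans_lt hfin).ne

end

theorem theorem2p4 (f : ℂ → ℂ) (hf : f ∈ PrimPick ∩ LogPick)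
    (μ : Measure ℝ) (hμ : IsReprMeasure f μ) :
    (μ.support.Nontrivial ↔ f ∈ (PrimPick ∩ LogPick) \ Elementary) ∧
    (f ∈ (PrimPick ∩ LogPick) \ Elementary →
      maxAtom μ Set.univ < μ Set.univ ∧ μ Set.univ ≤ 1 ∧
      (∀ᵐ x : ℝ, HasNontangentialReLimit f x (bdryU f x)) ∧
      (∀ y₁ y₂ p : ℝ, 0 < y₁ → y₁ < y₂ →
        1 / μ Set.univ < ENNReal.ofReal p → ENNReal.ofReal p < 1 / maxAtom μ Set.univ →
        ∫⁻ x : ℝ, ENNReal.ofReal (Real.exp (p * reU f x y₂)) <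
            ∫⁻ x : ℝ, ENNReal.ofReal (Real.exp (p * reU f x y₁)) ∧
          ∫⁻ x : ℝ, ENNReal.ofReal (Real.exp (p * reU f x y₁)) <
            ∫⁻ x : ℝ, ENNReal.ofReal (Real.exp (p * bdryU f x)) ∧
          ∫⁻ x : ℝ, ENNReal.ofReal (Real.exp (p * bdryU f x)) < ⊤) ∧
      (∀ p : ℝ, 1 / μ Set.univ < ENNReal.ofReal p →
        (∀ y : ℝ, 0 < y →
          ∫⁻ x : ℝ, ENNReal.ofReal (Real.exp (-p * reU f x y) / (1 + x ^ 2)) = ⊤) ∧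
        ∫⁻ x : ℝ, ENNReal.ofReal (Real.exp (-p * bdryU f x) / (1 + x ^ 2)) = ⊤)) := by
  obtain ⟨-, -, -, -, hsymm⟩ := hf.2
  have hiff := hμ.support_nontrivial_iff hsymm
  refine ⟨⟨fun h => ⟨hf, hiff.1 h⟩, fun h => hiff.2 h.2⟩, fun hnot => ?_⟩
  have hsupp := hiff.2 hnot.2
  obtain ⟨hfin, c, β, hc, hc1, hrep⟩ := hμ.exists_formula
  have hatom := maxAtom_lt_measure_univ hsupp
  have hm0 : μ Set.univ ≠ 0 := (bot_le.trans_lt hatom).ne'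
  have hμ0 : μ ≠ 0 := by simpa using hm0
  have hre : ∀ z : ℂ, 0 < z.im → (f z).re = β + logPotential μ z := by
    intro z hz
    rw [hrep z hz, Complex.add_re, re_integral_log_kernel μ hz]
    simp
  have hreU : ∀ x y : ℝ, 0 < y → reU f x y = β + logPotential μ (x + y * Complex.I) :=
    fun x y hy => hre _ (by simpa using hy)
  have hgood : ∀ᵐ x : ℝ, Integrable (logKernel x) μ ∧ μ {x} = 0 :=
    (ae_integrable_logKernel μ).and (ae_measure_singleton_eq_zero μ)
  have hbdry : ∀ᵐ x : ℝ, bdryU f x = β + logPotential μ x :=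
    hgood.mono fun x hx => (hasNontangentialReLimit_of_re_eq hre hx.1 hx.2).bdryU_eq
  have hmono : ∀ x y₁ y₂ : ℝ, 0 < y₁ → y₁ < y₂ → reU f x y₂ < reU f x y₁ := by
    intro x y₁ y₂ h1 h2
    have i1 : 0 < ((x : ℂ) + y₁ * Complex.I).im := by simpa using h1
    have i2 : 0 < ((x : ℂ) + y₂ * Complex.I).im := by simpa using h1.trans h2
    rw [hreU x y₁ h1, hreU x y₂ (h1.trans h2)]
    gcongr
    exact logPotential_lt_logPotential hμ0 h1.le h2
      (ae_of_all _ fun t => norm_ofReal_sub_pos_of_im_pos i1 t)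
      (integrable_logKernel i1 μ) (integrable_logKernel i2 μ)
  have hmono0 : ∀ y : ℝ, 0 < y → ∀ᵐ x : ℝ, reU f x y < bdryU f x := by
    intro y hy
    filter_upwards [hgood, hbdry] with x hx hb
    have i2 : 0 < ((x : ℂ) + y * Complex.I).im := by simpa using hy
    rw [hb, hreU x y hy]
    have hx0 : (x : ℂ) + ((0 : ℝ) : ℂ) * Complex.I = x := by simp
    have := logPotential_lt_logPotential (x := x) hμ0 le_rfl hy
      (by
        filter_upwards [ae_ne_of_measure_singleton hx.2] with t ht
        rw [hx0]
        exact norm_pos_iff.2 (sub_ne_zero.2 (by exact_mod_cast ht)))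
      (by rw [hx0]; exact hx.1) (integrable_logKernel i2 μ)
    rw [hx0] at this
    gcongr
  have hpos : ∀ p : ℝ, 1 / μ Set.univ < ENNReal.ofReal p → 0 < p ∧ 1 < p * μ.real Set.univ := by
    intro p hp
    have hp0 : 0 < p := ENNReal.ofReal_pos.1 (bot_le.trans_lt hp)
    rw [ENNReal.div_lt_iff (Or.inl hm0) (Or.inl (measure_ne_top _ _)),
      ← ofReal_measureReal (measure_ne_top _ _), ← ENNReal.ofReal_mul hp0.le,
      ENNReal.one_lt_ofReal] at hp
    exact ⟨hp0, hp⟩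
  refine ⟨hatom, ?_, ?_, ?_, ?_⟩
  · rw [← ofReal_measureReal (measure_ne_top _ _), ENNReal.ofReal_le_one]
    linarith
  · filter_upwards [hgood, hbdry] with x hx hb
    rw [hb]
    exact hasNontangentialReLimit_of_re_eq hre hx.1 hx.2
  · intro y₁ y₂ p h1 h2 hp hpJ
    obtain ⟨hp0, hpm⟩ := hpos p hp
    have hatoms : ∀ x, μ {x} < ENNReal.ofReal (1 / p) := by
      intro x
      have hle : μ {x} ≤ maxAtom μ Set.univ := le_iSup₂ (f := fun x _ => μ {x}) x (Set.mem_univ x)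
      rw [ENNReal.ofReal_div_of_pos hp0, ENNReal.ofReal_one]
      refine hle.trans_lt ?_
      rw [one_div] at hpJ ⊢
      -- Inversion in `ℝ≥0∞` includes the atomless case, where `1 / 0 = ⊤`.
      exact ENNReal.lt_inv_iff_lt_inv.1 hpJ
    have hVfin := lintegral_exp_logPotential_lt_top μ hp0 hpm hatoms
    have hbm : AEMeasurable (bdryU f) :=
      ⟨fun x => β + logPotential μ x,
        ((measurable_logPotential μ).comp Complex.measurable_ofReal).const_add β, hbdry⟩
    have hbfin : ∫⁻ x : ℝ, ENNReal.ofReal (Real.exp (p * bdryU f x)) < ⊤ := by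
      have e : ∫⁻ x : ℝ, ENNReal.ofReal (Real.exp (p * bdryU f x)) =
          ∫⁻ x : ℝ, ENNReal.ofReal (Real.exp (p * β)) *
            ENNReal.ofReal (Real.exp (p * logPotential μ x)) := by
        refine lintegral_congr_ae (hbdry.mono fun x hx => ?_)
        simp only [hx]
        rw [mul_add, Real.exp_add, ENNReal.ofReal_mul (Real.exp_pos _).le]
      rw [e, lintegral_const_mul' _ _ ENNReal.ofReal_ne_top]
      exact ENNReal.mul_lt_top ENNReal.ofReal_lt_top hVfin
    have hUm : AEMeasurable fun x => reU f x y₁ := by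
      have : (fun x => reU f x y₁) = fun x : ℝ => β + logPotential μ (x + y₁ * Complex.I) :=
        funext fun x => hreU x y₁ h1
      rw [this]
      exact (((measurable_logPotential μ).comp (by fun_prop)).const_add β).aemeasurable
    have hlt := lintegral_exp_lt_lintegral_exp hp0 hbm (hmono0 y₁ h1) hbfin
    exact ⟨lintegral_exp_lt_lintegral_exp hp0 hUm (ae_of_all _ fun x => hmono x y₁ y₂ h1 h2)
      (hlt.trans hbfin), hlt, hbfin⟩
  · intro p hp
    obtain ⟨hp0, hpm⟩ := hpos p hp
    have hb : ∫⁻ x : ℝ, ENNReal.ofReal (Real.exp (-p * bdryU f x) / (1 + x ^ 2)) = ⊤ := by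
      have e : ∫⁻ x : ℝ, ENNReal.ofReal (Real.exp (-p * bdryU f x) / (1 + x ^ 2)) =
          ∫⁻ x : ℝ, ENNReal.ofReal (Real.exp (-p * β)) *
            ENNReal.ofReal (Real.exp (-(p * logPotential μ x)) / (1 + x ^ 2)) := by
        refine lintegral_congr_ae (hbdry.mono fun x hx => ?_)
        simp only [hx]
        rw [← ENNReal.ofReal_mul (Real.exp_pos _).le, mul_add, Real.exp_add,
          neg_mul p (logPotential _ _), mul_div_assoc]
      rw [e, lintegral_const_mul' _ _ ENNReal.ofReal_ne_top,
        lintegral_exp_neg_logPotential_eq_top μ hp0 hpm]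
      exact ENNReal.mul_top (ENNReal.ofReal_pos.2 (Real.exp_pos _)).ne'
    refine ⟨fun y hy => ?_, hb⟩
    -- Since `reU f x y < bdryU f x` almost everywhere, the integrand at height `y` dominates the
    -- boundary one, whose integral already diverges.
    rw [eq_top_iff, ← hb]
    refine lintegral_mono_ae ((hmono0 y hy).mono fun x hx => ENNReal.ofReal_le_ofReal ?_)
    refine div_le_div_of_nonneg_right (Real.exp_le_exp.2 ?_) (by positivity)
    nlinarith
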